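/- Let $\Omega$ be a Polish space and let $\nu(du\,d\omega)$ be a $\sigma$-finite Borel measure on $(-1,1)\times\Omega$ with $\nu\big((-a,a)\times\Omega\big)=\infty$ for every $a\in(0,1]$ and $\iint_{(-1,1)\times\Omega}u^2\,\nu(du\,d\omega)<\infty$. Let $N$ be a Poisson random measure on $(-1,1)\times\Omega$ with intensity $\nu$, defined on a probability space with probability $\mathbb P$, and let $\tilde N=N-\nu$ be the compensated measure. The stochastic integral $\iint f\,d\tilde N$ of $f\in L^2(\nu)$ is the $L^2(\mathbb P)$-limit of $\iint\varphi_n\,dN-\iint\varphi_n\,d\nu$ for simple functions $\varphi_n$ supported on sets of finite $\nu$-measure with $\varphi_n\to f$ in $L^2(\nu)$; it is determined up to almost sure equality. Let $K:[0,1]\times\Omega\to\mathbb R$ be Borel measurable with $\iint_{(-1,1)\times\Omega}K^2(t,\omega)\,u^2\,\nu(du\,d\omega)<\infty$ for every $t\in[0,1]$, and suppose that for some $\alpha>0$ and some Borel measurable $C:\Omega\to[0,\infty)$ with $\iint_{(-1,1)\times\Omega}C(\omega)\,u^2\,\nu(du\,d\omega)<\infty$, $$|K(t,\omega)-K(s,\omega)|^2\le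 C(\omega)\,|t-s|^{1+\alpha},\qquad s,t\in[0,1],\ \omega\in\Omega.$$ For $0<\epsilon\le1$ consider the process $$X^\epsilon_t=\iint_{\{0<|u|<\epsilon\}\times\Omega}K(t,\omega)\,u\,\tilde N(du\,d\omega),\qquad t\in[0,1].$$ Then for every $\epsilon\in(0,1]$ the process $X^\epsilon$ has a version with continuous paths. Moreover, for any choice of separable (in Doob's sense; for instance, almost surely path-continuous) versions of the processes $X^\epsilon$ and for every $\delta>0$, $$\lim_{\epsilon\to0}\mathbb P\Big(\sup_{t\in[0,1]}|X^\epsilon_t|>\delta\Big)=0.$$ -/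

import Mathlib

open MeasureTheory ProbabilityTheory Filter Topology
open scoped NNReal ENNReal

noncomputable section

/-- `N` is a Poisson random measure on `E` with intensity measure `ν`, defined on the probability
space `(S, P)`: each `N s` is a measure, each `N B` is measurable, `N B` has the Poisson
distribution with mean `ν B` (which is the point mass at `∞` when `ν B = ∞`), and the values of
`N` on finitely many pairwise disjoint measurable sets are independent. -/
structure IsPoissonRandomMeasure {S E : Type*} [MeasurableSpace S] [MeasurableSpace E]
    (P : Measure S) (N : S → Measure E) (ν : Measure E) : Prop where
  measurable_apply : ∀ B : Set E, MeasurableSet B → Measurable (fun s => N s B)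
  law_of_finite : ∀ B : Set E, MeasurableSet B → ν B < ∞ →
    P.map (fun s => N s B) = (poissonMeasure (ν B).toNNReal).map (fun n : ℕ => (n : ℝ≥0∞))
  eq_top_of_infinite : ∀ B : Set E, MeasurableSet B → ν B = ∞ → ∀ᵐ s ∂P, N s B = ∞
  indep : ∀ (n : ℕ) (B : Fin n → Set E), (∀ i, MeasurableSet (B i)) →
    Pairwise (Function.onFun Disjoint B) → iIndepFun (fun i s => N s (B i)) P

/-- The integral of a simple function `φ` against the compensated measure `N - ν`. It is used
only for `φ` that vanishes outside a set of finite `ν`-measure, which has finite `N`-measure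
almost surely. -/
def simpleCompensatedIntegral {S E : Type*} [MeasurableSpace E]
    (N : S → Measure E) (ν : Measure E) (φ : SimpleFunc E ℝ) (s : S) : ℝ :=
  (∫ x, φ x ∂(N s)) - ∫ x, φ x ∂ν

/-- The random variable `Y` is (a version of) the stochastic integral of `f ∈ L²(ν)` against the
compensated measure `N - ν`: it is the `L²(P)`-limit of the integrals of some sequence of simple
functions with supports of finite `ν`-measure that converges to `f` in `L²(ν)`. -/
def IsCompensatedIntegral {S E : Type*} [MeasurableSpace S] [MeasurableSpace E]
    (P : Measure S) (N : S → Measure E) (ν : Measure E) (f : E → ℝ) (Y : S → ℝ) : Prop :=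
  MemLp f 2 ν ∧ MemLp Y 2 P ∧
    ∃ φ : ℕ → SimpleFunc E ℝ, (∀ n, ν (Function.support (φ n)) < ∞) ∧
      Tendsto (fun n => eLpNorm (fun x => φ n x - f x) 2 ν) atTop (𝓝 0) ∧
      Tendsto (fun n => eLpNorm (fun s => simpleCompensatedIntegral N ν (φ n) s - Y s) 2 P)
        atTop (𝓝 0)

/-- The integrand `K(t, ω) u` restricted to `0 < |u| < ε`. -/
def truncatedIntegrand {Ω : Type*} (K : Set.Icc (0 : ℝ) 1 → Ω → ℝ) (ε : ℝ)
    (t : Set.Icc (0 : ℝ) 1) : Set.Ioo (-1 : ℝ) 1 × Ω → ℝ :=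
  Set.indicator {x | 0 < |(x.1 : ℝ)| ∧ |(x.1 : ℝ)| < ε} (fun x => K t x.2 * (x.1 : ℝ))

/-- `X` is a version of the process `X^ε_t = ∬_{0 < |u| < ε} K(t, ω) u (N - ν)(du dω)`, with
`t ∈ [0, 1]`. The stochastic integrals determine each `X t` up to almost sure equality. -/
def IsVersionOfProcess {S Ω : Type*} [MeasurableSpace S] [MeasurableSpace Ω]
    (P : Measure S) (N : S → Measure (Set.Ioo (-1 : ℝ) 1 × Ω))
    (ν : Measure (Set.Ioo (-1 : ℝ) 1 × Ω)) (K : Set.Icc (0 : ℝ) 1 → Ω → ℝ) (ε : ℝ)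
    (X : Set.Icc (0 : ℝ) 1 → S → ℝ) : Prop :=
  ∀ t, IsCompensatedIntegral P N ν (truncatedIntegrand K ε t) (X t)

/-- Doob's separability of a real-valued process: for a countable set `D` of times, almost every
path has its graph in the closure of its graph over `D`. Processes whose paths are almost surely
continuous are separable. -/
def IsSeparableProcess {S T : Type*} [MeasurableSpace S] [TopologicalSpace T]
    (P : Measure S) (X : T → S → ℝ) : Prop :=
  ∃ D : Set T, D.Countable ∧
    ∀ᵐ s ∂P, ∀ t, (t, X t s) ∈ closure ((fun r => (r, X r s)) '' D)

end

/-! ### Moments of the Poisson distribution -/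

/-! The argument is an L² isometry followed by Kolmogorov chaining with constants that are tracked
in ε.

For a simple φ the compensated integral is a sum over the disjoint level sets of φ. Independence and
the Poisson variance give E[I(φ)²] = ∫ φ² dν (`integral_simpleCompensatedIntegral_sq`). In the
limit, ‖Y - Z‖₂ ≤ ‖f - g‖₂ for integrals Y, Z of f, g (`eLpNorm_sub_le`). The Hölder condition on K
then yields ‖X_t - X_r‖₂ ≤ c(ε) |t - r|^((1+α)/2), where c(ε) is the L²(ν) norm of √C·u on {0 < |u|
< ε}.

At dyadic level n there are 2^n increments, each of second moment at most c(ε)² 2^(-n(1+α)), so the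
root of their sum of squares has mean at most c(ε) 2^(-nα/2). Summing over n gives a continuous
modification Y and a variable R with |X_0 - Y_t| ≤ R for all t and E R ≤ κ c(ε), where κ = 1/(1 -
2^(-α/2)) (`exists_continuous_modification`).

A separable version agrees with Y at all times almost surely, so Markov's inequality bounds the
probability by (‖X_0‖₂ + κ c(ε))/δ. Both terms tend to 0 by dominated convergence. -/

theorem hasSum_poisson_mul_natCast (r : ℝ) :
    HasSum (fun n : ℕ => Real.exp (-r) * r ^ n / n.factorial * n) r := by
  have h0 : HasSum (fun n : ℕ => r ^ n / n.factorial) (Real.exp r) := by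
    rw [Real.exp_eq_exp_ℝ]; exact NormedSpace.expSeries_div_hasSum_exp r
  rw [← hasSum_nat_add_iff' 1]
  convert! h0.mul_left (Real.exp (-r) * r) using 1
  · ext n
    rw [Nat.factorial_succ]
    push_cast
    rw [pow_succ]
    field_simp
  · simp only [Finset.range_one, Finset.sum_singleton, Nat.cast_zero, mul_zero, sub_zero]
    rw [mul_right_comm, ← Real.exp_add]; simp

theorem hasSum_poisson_mul_natCast_sq (r : ℝ) :
    HasSum (fun n : ℕ => Real.exp (-r) * r ^ n / n.factorial * (n : ℝ) ^ 2) (r ^ 2 + r) := by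
  have h0 : HasSum (fun n : ℕ => r ^ n / n.factorial) (Real.exp r) := by
    rw [Real.exp_eq_exp_ℝ]; exact NormedSpace.expSeries_div_hasSum_exp r
  rw [← hasSum_nat_add_iff' 1]
  -- After the vanishing term n = 0 is dropped, (n+1)²/(n+1)! = n/n! + 1/n!: r times the first
  -- moment, plus r.
  convert! ((hasSum_poisson_mul_natCast r).mul_left r).add (h0.mul_left (Real.exp (-r) * r)) using 1
  · ext n
    rw [Nat.factorial_succ]
    push_cast
    rw [pow_succ]
    field_simp
  · simp only [Finset.range_one, Finset.sum_singleton, Nat.cast_zero]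
    rw [mul_right_comm, ← Real.exp_add]; simp; ring

theorem integrable_natCast_sq_poissonMeasure (r : ℝ≥0) :
    Integrable (fun n : ℕ => (n : ℝ) ^ 2) (poissonMeasure r) := by
  rw [integrable_poissonMeasure_iff]
  simpa using (hasSum_poisson_mul_natCast_sq r).summable

theorem integral_natCast_poissonMeasure (r : ℝ≥0) :
    ∫ n : ℕ, (n : ℝ) ∂(poissonMeasure r) = r := by
  rw [integral_poissonMeasure]
  simpa using (hasSum_poisson_mul_natCast r).tsum_eq

theorem integral_natCast_sq_poissonMeasure (r : ℝ≥0) :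
    ∫ n : ℕ, (n : ℝ) ^ 2 ∂(poissonMeasure r) = (r : ℝ) ^ 2 + r := by
  rw [integral_poissonMeasure]
  simpa using (hasSum_poisson_mul_natCast_sq r).tsum_eq

/-! ### Second moments of integrals of simple functions -/

namespace IsPoissonRandomMeasure

variable {S E : Type*} [MeasurableSpace S] [MeasurableSpace E] {P : Measure S}
  {N : S → Measure E} {ν : Measure E}

theorem measurable_real (hN : IsPoissonRandomMeasure P N ν) {B : Set E} (hB : MeasurableSet B) :
    Measurable (fun s => (N s).real B) :=
  (hN.measurable_apply B hB).ennreal_toReal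

theorem ae_lt_top (hN : IsPoissonRandomMeasure P N ν) {B : Set E} (hB : MeasurableSet B)
    (hνB : ν B < ∞) : ∀ᵐ s ∂P, N s B < ∞ := by
  have h : ∀ᵐ x ∂(P.map fun s => N s B), x < ∞ := by
    rw [hN.law_of_finite B hB hνB, ae_map_iff (by fun_prop) measurableSet_Iio]
    simp
  exact ae_of_ae_map (hN.measurable_apply B hB).aemeasurable h

theorem integrable_comp_iff (hN : IsPoissonRandomMeasure P N ν) {B : Set E}
    (hB : MeasurableSet B) (hνB : ν B < ∞) {g : ℝ → ℝ} (hg : Measurable g) :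
    Integrable (fun s => g ((N s).real B)) P ↔
      Integrable (fun n : ℕ => g n) (poissonMeasure (ν B).toNNReal) := by
  have hm : Measurable fun x : ℝ≥0∞ => g x.toReal := hg.comp ENNReal.measurable_toReal
  have h1 := integrable_map_measure (μ := P) (g := fun x : ℝ≥0∞ => g x.toReal)
    hm.aestronglyMeasurable (hN.measurable_apply B hB).aemeasurable
  have h2 := integrable_map_measure (μ := poissonMeasure (ν B).toNNReal)
    (f := fun n : ℕ => (n : ℝ≥0∞)) (g := fun x : ℝ≥0∞ => g x.toReal)
    hm.aestronglyMeasurable (by fun_prop)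
  rw [hN.law_of_finite B hB hνB, h2] at h1
  simpa [Function.comp_def, Measure.real] using h1.symm

theorem integral_comp (hN : IsPoissonRandomMeasure P N ν) {B : Set E}
    (hB : MeasurableSet B) (hνB : ν B < ∞) {g : ℝ → ℝ} (hg : Measurable g) :
    ∫ s, g ((N s).real B) ∂P = ∫ n : ℕ, g n ∂(poissonMeasure (ν B).toNNReal) := by
  have hm : Measurable fun x : ℝ≥0∞ => g x.toReal := hg.comp ENNReal.measurable_toReal
  have h1 := integral_map (μ := P) (f := fun x : ℝ≥0∞ => g x.toReal)
    (hN.measurable_apply B hB).aemeasurable hm.aestronglyMeasurable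
  have h2 := integral_map (μ := poissonMeasure (ν B).toNNReal)
    (φ := fun n : ℕ => (n : ℝ≥0∞)) (f := fun x : ℝ≥0∞ => g x.toReal)
    (by fun_prop) hm.aestronglyMeasurable
  rw [hN.law_of_finite B hB hνB, h2] at h1
  simpa [Measure.real] using h1.symm

theorem memLp_real (hN : IsPoissonRandomMeasure P N ν) {B : Set E}
    (hB : MeasurableSet B) (hνB : ν B < ∞) : MemLp (fun s => (N s).real B) 2 P := by
  rw [memLp_two_iff_integrable_sq (hN.measurable_real hB).aestronglyMeasurable,
    hN.integrable_comp_iff hB hνB (g := fun x => x ^ 2) (by fun_prop)]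
  exact integrable_natCast_sq_poissonMeasure _

theorem integral_real (hN : IsPoissonRandomMeasure P N ν) {B : Set E}
    (hB : MeasurableSet B) (hνB : ν B < ∞) : ∫ s, (N s).real B ∂P = ν.real B := by
  rw [hN.integral_comp hB hνB (g := fun x => x) measurable_id, integral_natCast_poissonMeasure]
  rfl

theorem variance_real [IsProbabilityMeasure P] (hN : IsPoissonRandomMeasure P N ν) {B : Set E}
    (hB : MeasurableSet B) (hνB : ν B < ∞) :
    variance (fun s => (N s).real B) P = ν.real B := by
  rw [variance_eq_sub (hN.memLp_real hB hνB), hN.integral_real hB hνB]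
  have := hN.integral_comp hB hνB (g := fun x => x ^ 2) (by fun_prop)
  simp only [Pi.pow_apply]
  rw [this, integral_natCast_sq_poissonMeasure]
  have : (((ν B).toNNReal : ℝ≥0) : ℝ) = ν.real B := rfl
  rw [this]; ring

theorem indepFun_real (hN : IsPoissonRandomMeasure P N ν) {A B : Set E} (hA : MeasurableSet A)
    (hB : MeasurableSet B) (hAB : Disjoint A B) :
    IndepFun (fun s => (N s).real A) (fun s => (N s).real B) P := by
  have h := hN.indep 2 ![A, B] (by intro i; fin_cases i <;> assumption) (by
    intro i j hij
    fin_cases i <;> fin_cases j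
    · exact absurd rfl hij
    · exact hAB
    · exact hAB.symm
    · exact absurd rfl hij)
  have h01 := h.indepFun (i := 0) (j := 1) (by decide)
  exact h01.comp ENNReal.measurable_toReal ENNReal.measurable_toReal

end IsPoissonRandomMeasure

theorem MeasureTheory.SimpleFunc.measure_preimage_singleton_lt_top {E : Type*} [MeasurableSpace E]
    {ν : Measure E} {φ : SimpleFunc E ℝ} (hφ : ν (Function.support φ) < ∞) {c : ℝ} (hc : c ≠ 0) :
    ν (φ ⁻¹' {c}) < ∞ :=
  SimpleFunc.finMeasSupp_iff.1 (SimpleFunc.finMeasSupp_iff_support.2 hφ) c hc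

namespace IsPoissonRandomMeasure

variable {S E : Type*} [MeasurableSpace S] [MeasurableSpace E] {P : Measure S}
  {N : S → Measure E} {ν : Measure E}

theorem ae_integrable_simpleFunc (hN : IsPoissonRandomMeasure P N ν) {φ : SimpleFunc E ℝ}
    (hφ : ν (Function.support φ) < ∞) : ∀ᵐ s ∂P, Integrable φ (N s) := by
  filter_upwards [hN.ae_lt_top φ.measurableSet_support hφ] with s hs
  exact SimpleFunc.integrable_iff_finMeasSupp.2 (SimpleFunc.finMeasSupp_iff_support.2 hs)

theorem simpleCompensatedIntegral_ae_eq (hN : IsPoissonRandomMeasure P N ν) {φ : SimpleFunc E ℝ}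
    (hφ : ν (Function.support φ) < ∞) :
    simpleCompensatedIntegral N ν φ =ᵐ[P]
      ∑ c ∈ φ.range, fun s => c * ((N s).real (φ ⁻¹' {c}) - ν.real (φ ⁻¹' {c})) := by
  filter_upwards [hN.ae_integrable_simpleFunc hφ] with s hs
  have hν : Integrable φ ν :=
    SimpleFunc.integrable_iff_finMeasSupp.2 (SimpleFunc.finMeasSupp_iff_support.2 hφ)
  rw [simpleCompensatedIntegral, SimpleFunc.integral_eq_sum _ hs, SimpleFunc.integral_eq_sum _ hν,
    ← Finset.sum_sub_distrib, Finset.sum_apply]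
  refine Finset.sum_congr rfl fun c _ => ?_
  simp only [smul_eq_mul]; ring

theorem memLp_const_mul_compensated [IsProbabilityMeasure P] (hN : IsPoissonRandomMeasure P N ν)
    {φ : SimpleFunc E ℝ} (hφ : ν (Function.support φ) < ∞) (c : ℝ) :
    MemLp (fun s => c * ((N s).real (φ ⁻¹' {c}) - ν.real (φ ⁻¹' {c}))) 2 P := by
  -- The zero level set may have infinite measure, but its coefficient is 0; every other level set
  -- has finite measure.
  rcases eq_or_ne c 0 with rfl | hc
  · simp
  · exact ((hN.memLp_real (φ.measurableSet_preimage _)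
      (SimpleFunc.measure_preimage_singleton_lt_top hφ hc)).sub (memLp_const _)).const_mul c

theorem memLp_simpleCompensatedIntegral [IsProbabilityMeasure P]
    (hN : IsPoissonRandomMeasure P N ν) {φ : SimpleFunc E ℝ} (hφ : ν (Function.support φ) < ∞) :
    MemLp (simpleCompensatedIntegral N ν φ) 2 P :=
  (memLp_congr_ae (hN.simpleCompensatedIntegral_ae_eq hφ)).2
    (memLp_finsetSum' _ fun c _ => hN.memLp_const_mul_compensated hφ c)

theorem integral_simpleCompensatedIntegral [IsProbabilityMeasure P]
    (hN : IsPoissonRandomMeasure P N ν) {φ : SimpleFunc E ℝ} (hφ : ν (Function.support φ) < ∞) :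
    ∫ s, simpleCompensatedIntegral N ν φ s ∂P = 0 := by
  rw [integral_congr_ae (hN.simpleCompensatedIntegral_ae_eq hφ)]
  simp only [Finset.sum_apply]
  rw [integral_finsetSum _ fun c _ =>
    (hN.memLp_const_mul_compensated hφ c).integrable one_le_two]
  refine Finset.sum_eq_zero fun c _ => ?_
  rcases eq_or_ne c 0 with rfl | hc
  · simp
  · have hfin := SimpleFunc.measure_preimage_singleton_lt_top hφ hc
    have hm := φ.measurableSet_preimage {c}
    rw [integral_const_mul, integral_sub ((hN.memLp_real hm hfin).integrable one_le_two)
      (integrable_const _), hN.integral_real hm hfin]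
    simp

/-- The integral is centred, so its second moment is its variance. Variances add over the
independent level sets, and {φ = c} contributes c² times its ν-measure. -/
theorem integral_simpleCompensatedIntegral_sq [IsProbabilityMeasure P]
    (hN : IsPoissonRandomMeasure P N ν) {φ : SimpleFunc E ℝ} (hφ : ν (Function.support φ) < ∞) :
    ∫ s, simpleCompensatedIntegral N ν φ s ^ 2 ∂P = ∫ x, φ x ^ 2 ∂ν := by
  have hν : Integrable φ ν :=
    SimpleFunc.integrable_iff_finMeasSupp.2 (SimpleFunc.finMeasSupp_iff_support.2 hφ)
  have hL := hN.memLp_simpleCompensatedIntegral hφ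
  have h1 := variance_of_integral_eq_zero hL.aestronglyMeasurable.aemeasurable
    (hN.integral_simpleCompensatedIntegral hφ)
  rw [← h1, variance_congr (hN.simpleCompensatedIntegral_ae_eq hφ),
    IndepFun.variance_sum (fun c _ => hN.memLp_const_mul_compensated hφ c)]
  · have h2 : ∫ x, φ x ^ 2 ∂ν = (φ.map (fun y : ℝ => y ^ 2)).integral ν := by
      rw [SimpleFunc.integral_eq_integral]
      · simp
      · exact ((SimpleFunc.finMeasSupp_iff_support.2 hφ).map (by simp)).integrable
    rw [h2, SimpleFunc.map_integral _ _ hν (by simp)]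
    refine Finset.sum_congr rfl fun c _ => ?_
    rcases eq_or_ne c 0 with rfl | hc
    · simp only [zero_mul, smul_eq_mul, ne_eq, OfNat.ofNat_ne_zero, not_false_eq_true, zero_pow,
        mul_zero]
      exact variance_zero P
    · have hfin := SimpleFunc.measure_preimage_singleton_lt_top hφ hc
      have hm := φ.measurableSet_preimage {c}
      rw [variance_const_mul, variance_sub_const (hN.measurable_real hm).aestronglyMeasurable,
        hN.variance_real hm hfin, smul_eq_mul, mul_comm]
  · intro a _ b _ hab
    have h := hN.indepFun_real (φ.measurableSet_preimage {a}) (φ.measurableSet_preimage {b})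
      (Disjoint.preimage _ (by simpa using hab))
    exact h.comp (φ := fun x => a * (x - ν.real (φ ⁻¹' {a})))
      (ψ := fun x => b * (x - ν.real (φ ⁻¹' {b}))) (by fun_prop) (by fun_prop)

theorem eLpNorm_simpleCompensatedIntegral [IsProbabilityMeasure P]
    (hN : IsPoissonRandomMeasure P N ν) {φ : SimpleFunc E ℝ} (hφ : ν (Function.support φ) < ∞) :
    eLpNorm (simpleCompensatedIntegral N ν φ) 2 P = eLpNorm φ 2 ν := by
  have hν : MemLp φ 2 ν :=
    (SimpleFunc.memLp_iff_finMeasSupp (by simp) (by simp)).2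
      (SimpleFunc.finMeasSupp_iff_support.2 hφ)
  rw [(hN.memLp_simpleCompensatedIntegral hφ).eLpNorm_eq_integral_rpow_norm (by simp) (by simp),
    hν.eLpNorm_eq_integral_rpow_norm (by simp) (by simp)]
  simp only [ENNReal.toReal_ofNat, Real.rpow_ofNat, Real.norm_eq_abs, sq_abs]
  rw [hN.integral_simpleCompensatedIntegral_sq hφ]

theorem simpleCompensatedIntegral_sub_ae_eq (hN : IsPoissonRandomMeasure P N ν)
    {φ ψ : SimpleFunc E ℝ} (hφ : ν (Function.support φ) < ∞) (hψ : ν (Function.support ψ) < ∞) :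
    (fun s => simpleCompensatedIntegral N ν φ s - simpleCompensatedIntegral N ν ψ s) =ᵐ[P]
      simpleCompensatedIntegral N ν (φ - ψ) := by
  have hφν : Integrable φ ν :=
    SimpleFunc.integrable_iff_finMeasSupp.2 (SimpleFunc.finMeasSupp_iff_support.2 hφ)
  have hψν : Integrable ψ ν :=
    SimpleFunc.integrable_iff_finMeasSupp.2 (SimpleFunc.finMeasSupp_iff_support.2 hψ)
  filter_upwards [hN.ae_integrable_simpleFunc hφ, hN.ae_integrable_simpleFunc hψ] with s h1 h2
  simp only [simpleCompensatedIntegral, SimpleFunc.coe_sub, Pi.sub_apply]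
  rw [integral_sub h1 h2, integral_sub hφν hψν]
  ring

theorem eLpNorm_simpleCompensatedIntegral_sub [IsProbabilityMeasure P]
    (hN : IsPoissonRandomMeasure P N ν) {φ ψ : SimpleFunc E ℝ}
    (hφ : ν (Function.support φ) < ∞) (hψ : ν (Function.support ψ) < ∞) :
    eLpNorm (fun s => simpleCompensatedIntegral N ν φ s - simpleCompensatedIntegral N ν ψ s) 2 P =
      eLpNorm (fun x => φ x - ψ x) 2 ν := by
  rw [eLpNorm_congr_ae (hN.simpleCompensatedIntegral_sub_ae_eq hφ hψ),
    hN.eLpNorm_simpleCompensatedIntegral]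
  · rfl
  · refine (measure_mono ?_).trans_lt (measure_union_lt_top hφ hψ)
    rw [SimpleFunc.coe_sub]
    exact Function.support_sub _ _

end IsPoissonRandomMeasure

/-! ### Compensated integrals of square integrable functions -/

namespace IsCompensatedIntegral

variable {S E : Type*} [MeasurableSpace S] [MeasurableSpace E] {P : Measure S}
  {N : S → Measure E} {ν : Measure E}

theorem zero : IsCompensatedIntegral P N ν (fun _ => 0) (fun _ => 0) := by
  refine ⟨MemLp.zero', MemLp.zero', fun _ => 0, ?_, ?_, ?_⟩
  · simp
  · simp
  · simp [simpleCompensatedIntegral]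

theorem congr_ae {f : E → ℝ} {Y Z : S → ℝ} (hY : IsCompensatedIntegral P N ν f Y)
    (hYZ : Y =ᵐ[P] Z) : IsCompensatedIntegral P N ν f Z := by
  obtain ⟨hf, hYm, φ, h1, h2, h3⟩ := hY
  refine ⟨hf, (memLp_congr_ae hYZ).1 hYm, φ, h1, h2, h3.congr fun n => eLpNorm_congr_ae ?_⟩
  filter_upwards [hYZ] with s hs
  rw [hs]

/-- The triangle inequality through the approximating integrals, whose mutual distance is known from
the isometry. The approximants may come from unrelated sequences, so f = g gives almost sure
uniqueness. -/
theorem eLpNorm_sub_le [IsProbabilityMeasure P] (hN : IsPoissonRandomMeasure P N ν)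
    {f g : E → ℝ} {Y Z : S → ℝ} (hY : IsCompensatedIntegral P N ν f Y)
    (hZ : IsCompensatedIntegral P N ν g Z) :
    eLpNorm (fun s => Y s - Z s) 2 P ≤ eLpNorm (fun x => f x - g x) 2 ν := by
  obtain ⟨hf, hYm, φ, hφ, hφf, hφY⟩ := hY
  obtain ⟨hg, hZm, ψ, hψ, hψg, hψZ⟩ := hZ
  have hlim : Tendsto (fun n =>
      eLpNorm (fun s => simpleCompensatedIntegral N ν (φ n) s - Y s) 2 P +
      ((eLpNorm (fun x => φ n x - f x) 2 ν + eLpNorm (fun x => f x - g x) 2 ν +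
        eLpNorm (fun x => ψ n x - g x) 2 ν) +
      eLpNorm (fun s => simpleCompensatedIntegral N ν (ψ n) s - Z s) 2 P)) atTop
      (𝓝 (0 + ((0 + eLpNorm (fun x => f x - g x) 2 ν + 0) + 0))) :=
    hφY.add (((hφf.add tendsto_const_nhds).add hψg).add hψZ)
  simp only [zero_add, add_zero] at hlim
  refine ge_of_tendsto' hlim fun n => ?_
  have hI := hN.memLp_simpleCompensatedIntegral (hφ n)
  have hJ := hN.memLp_simpleCompensatedIntegral (hψ n)
  have hφm := (φ n).stronglyMeasurable.aestronglyMeasurable (μ := ν)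
  have hψm := (ψ n).stronglyMeasurable.aestronglyMeasurable (μ := ν)
  have e1 : (fun s => Y s - Z s) =
      (Y - simpleCompensatedIntegral N ν (φ n)) +
        ((fun s => simpleCompensatedIntegral N ν (φ n) s -
          simpleCompensatedIntegral N ν (ψ n) s) +
        (fun s => simpleCompensatedIntegral N ν (ψ n) s - Z s)) := by
    ext s; simp
  have e2 : (fun x => φ n x - ψ n x) =
      ((fun x => φ n x - f x) + fun x => f x - g x) + (g - ⇑(ψ n)) := by
    ext x; simp
  rw [e1]
  refine (eLpNorm_add_le (hYm.sub hI).1 ((hI.sub hJ).add (hJ.sub hZm)).1 one_le_two).trans ?_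
  refine add_le_add (eLpNorm_sub_comm _ _ _ _).le ?_
  refine (eLpNorm_add_le (hI.sub hJ).1 (hJ.sub hZm).1 one_le_two).trans ?_
  refine add_le_add_left ?_ _
  refine (hN.eLpNorm_simpleCompensatedIntegral_sub (hφ n) (hψ n)).le.trans ?_
  rw [e2]
  refine (eLpNorm_add_le ((hφm.sub hf.1).add (hf.1.sub hg.1)) (hg.1.sub hψm) one_le_two).trans ?_
  refine add_le_add (eLpNorm_add_le (hφm.sub hf.1) (hf.1.sub hg.1) one_le_two) ?_
  exact (eLpNorm_sub_comm _ _ _ _).le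

theorem eLpNorm_le [IsProbabilityMeasure P] (hN : IsPoissonRandomMeasure P N ν)
    {f : E → ℝ} {Y : S → ℝ} (hY : IsCompensatedIntegral P N ν f Y) :
    eLpNorm Y 2 P ≤ eLpNorm f 2 ν := by
  simpa using hY.eLpNorm_sub_le hN IsCompensatedIntegral.zero

end IsCompensatedIntegral

theorem IsPoissonRandomMeasure.exists_isCompensatedIntegral {S E : Type*} [MeasurableSpace S]
    [MeasurableSpace E] {P : Measure S} [IsProbabilityMeasure P] {N : S → Measure E}
    {ν : Measure E} (hN : IsPoissonRandomMeasure P N ν) {f : E → ℝ} (hf : MemLp f 2 ν) :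
    ∃ Y, IsCompensatedIntegral P N ν f Y := by
  -- A summable rate of approximation, as `Lp.cauchy_complete_eLpNorm` asks for summable Cauchy
  -- bounds; the isometry turns it into the bound `b n + b n` for the integrals.
  let b : ℕ → ℝ≥0∞ := fun n => 2⁻¹ ^ n
  have hb : ∀ n, b n ≠ 0 := fun n => pow_ne_zero _ (by simp)
  have hb_anti : ∀ m n, m ≤ n → b n ≤ b m := fun m n h =>
    pow_le_pow_right_of_le_one' (ENNReal.inv_le_one.2 one_le_two) h
  have hb_sum : ∑' n, b n ≠ ∞ := by
    simp only [b, ENNReal.tsum_geometric]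
    simp
  choose φ hφ hφm using fun n => hf.exists_simpleFunc_eLpNorm_sub_lt (by simp) (hb n)
  have hφs : ∀ n, ν (Function.support (φ n)) < ∞ := fun n =>
    SimpleFunc.measure_support_lt_top_of_memLp _ (hφm n) (by simp) (by simp)
  have hI := fun n => hN.memLp_simpleCompensatedIntegral (hφs n)
  obtain ⟨Y, hY, hlim⟩ := Lp.cauchy_complete_eLpNorm one_le_two hI (B := fun n => b n + b n)
    (by rw [ENNReal.tsum_add]; simp [hb_sum]) (by
      intro k n m hn hm
      have h := hN.eLpNorm_simpleCompensatedIntegral_sub (hφs n) (hφs m)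
      have e : (fun x => φ n x - φ m x) = (⇑(φ n) - f) + (f - ⇑(φ m)) := by ext x; simp
      refine h.trans_lt ?_
      rw [e]
      refine (eLpNorm_add_le ((hφm n).sub hf).1 (hf.sub (hφm m)).1 one_le_two).trans_lt ?_
      rw [eLpNorm_sub_comm]
      exact ENNReal.add_lt_add ((hφ n).trans_le (hb_anti _ _ hn))
        ((hφ m).trans_le (hb_anti _ _ hm)))
  refine ⟨Y, hf, hY, φ, hφs, ?_, hlim⟩
  refine tendsto_of_tendsto_of_tendsto_of_le_of_le tendsto_const_nhds
    (ENNReal.tendsto_atTop_zero_of_tsum_ne_top hb_sum) (fun _ => zero_le) fun n => ?_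
  change eLpNorm (⇑(φ n) - f) 2 ν ≤ b n
  rw [eLpNorm_sub_comm]
  exact (hφ n).le

/-! ### Chaining along dyadic points of the unit interval -/

/-- The dyadic number `k / 2 ^ n`, projected to the unit interval. -/
noncomputable def dyadicPoint (n k : ℕ) : Set.Icc (0 : ℝ) 1 :=
  Set.projIcc 0 1 zero_le_one ((k : ℝ) / 2 ^ n)

/-- The largest dyadic number of level `n` that is at most `t`. -/
noncomputable def dyadicFloor (n : ℕ) (t : Set.Icc (0 : ℝ) 1) : Set.Icc (0 : ℝ) 1 :=
  dyadicPoint n ⌊(t : ℝ) * 2 ^ n⌋₊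

theorem floor_mul_two_pow_le (n : ℕ) (t : Set.Icc (0 : ℝ) 1) : ⌊(t : ℝ) * 2 ^ n⌋₊ ≤ 2 ^ n := by
  have h : (t : ℝ) * 2 ^ n ≤ ((2 ^ n : ℕ) : ℝ) := by
    push_cast
    exact mul_le_of_le_one_left (by positivity) t.2.2
  exact Nat.floor_le_of_le h

theorem coe_dyadicPoint {n k : ℕ} (hk : k ≤ 2 ^ n) : (dyadicPoint n k : ℝ) = k / 2 ^ n := by
  have h : (k : ℝ) / 2 ^ n ≤ 1 := by
    rw [div_le_one (by positivity)]
    exact_mod_cast hk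
  rw [dyadicPoint, Set.projIcc_of_mem _ ⟨by positivity, h⟩]

theorem dyadicPoint_succ_two_mul (n k : ℕ) : dyadicPoint (n + 1) (2 * k) = dyadicPoint n k := by
  unfold dyadicPoint
  congr 1
  push_cast
  rw [pow_succ]
  field_simp

theorem dyadicPoint_zero_right (n : ℕ) : dyadicPoint n 0 = 0 := by
  ext
  rw [coe_dyadicPoint (by positivity)]
  simp

theorem abs_dyadicFloor_sub_le (n : ℕ) (t : Set.Icc (0 : ℝ) 1) :
    |(dyadicFloor n t : ℝ) - t| ≤ (1 / 2) ^ n := by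
  rw [dyadicFloor, coe_dyadicPoint (floor_mul_two_pow_le n t), abs_sub_comm, abs_of_nonneg]
  · rw [sub_le_iff_le_add, one_div, inv_pow, ← one_div, ← add_div, le_div_iff₀ (by positivity),
      add_comm]
    exact (Nat.lt_floor_add_one _).le
  · rw [sub_nonneg, div_le_iff₀ (by positivity)]
    exact Nat.floor_le (mul_nonneg t.2.1 (by positivity))

section Paths

variable {x : Set.Icc (0 : ℝ) 1 → ℝ} {m : ℕ → ℝ≥0∞}

/-- Halving the index at level n + 1 gives the index at level n, so the two floors coincide or are
neighbours at level n + 1. -/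
theorem edist_dyadicFloor_succ_le
    (hx : ∀ n, ∀ k < 2 ^ n, edist (x (dyadicPoint n k)) (x (dyadicPoint n (k + 1))) ≤ m n)
    (n : ℕ) (t : Set.Icc (0 : ℝ) 1) :
    edist (x (dyadicFloor n t)) (x (dyadicFloor (n + 1) t)) ≤ m (n + 1) := by
  have hfl : ⌊(t : ℝ) * 2 ^ n⌋₊ = ⌊(t : ℝ) * 2 ^ (n + 1)⌋₊ / 2 := by
    rw [← Nat.floor_div_natCast]
    congr 1
    push_cast
    ring
  have hle := floor_mul_two_pow_le (n + 1) t
  rw [dyadicFloor, dyadicFloor, hfl]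
  set k := ⌊(t : ℝ) * 2 ^ (n + 1)⌋₊
  rw [← dyadicPoint_succ_two_mul]
  rcases Nat.even_or_odd' k with ⟨j, hj | hj⟩
  · have h2 : 2 * (k / 2) = k := by omega
    rw [h2]
    simp
  · have h2 : 2 * (k / 2) + 1 = k := by omega
    have := hx (n + 1) (2 * (k / 2)) (by omega)
    rwa [h2] at this

/-- Times less than one mesh width apart have equal or adjacent floors. -/
theorem edist_dyadicFloor_le
    (hx : ∀ n, ∀ k < 2 ^ n, edist (x (dyadicPoint n k)) (x (dyadicPoint n (k + 1))) ≤ m n)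
    (n : ℕ) {s t : Set.Icc (0 : ℝ) 1} (hst : |(s : ℝ) - t| < (1 / 2) ^ n) :
    edist (x (dyadicFloor n s)) (x (dyadicFloor n t)) ≤ m n := by
  wlog h : (s : ℝ) ≤ t generalizing s t
  · rw [edist_comm]
    exact this (by rwa [abs_sub_comm]) (le_of_not_ge h)
  have h1 : ⌊(s : ℝ) * 2 ^ n⌋₊ ≤ ⌊(t : ℝ) * 2 ^ n⌋₊ :=
    Nat.floor_le_floor (mul_le_mul_of_nonneg_right h (by positivity))
  have h2 : ⌊(t : ℝ) * 2 ^ n⌋₊ ≤ ⌊(s : ℝ) * 2 ^ n⌋₊ + 1 := by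
    rw [← Nat.floor_add_one (mul_nonneg s.2.1 (by positivity))]
    refine Nat.floor_le_floor ?_
    have h3 : (t : ℝ) - s ≤ (1 / 2) ^ n := (neg_le_abs _).trans hst.le |>.trans' (by linarith)
    have h4 := mul_le_mul_of_nonneg_right h3 (by positivity : (0 : ℝ) ≤ 2 ^ n)
    rw [← mul_pow] at h4
    norm_num at h4
    linarith
  have h5 := floor_mul_two_pow_le n t
  rw [dyadicFloor, dyadicFloor]
  rcases h1.eq_or_lt with h6 | h6
  · rw [h6]; simp
  · have h7 : ⌊(t : ℝ) * 2 ^ n⌋₊ = ⌊(s : ℝ) * 2 ^ n⌋₊ + 1 := le_antisymm h2 h6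
    rw [h7]
    exact hx n _ (by omega)

/-- The limit y is built from the values of x at dyadic points only, and x itself need not be
continuous. Continuity follows by passing from s to its floor, to the floor of t, and to t. -/
theorem exists_continuous_of_dyadic
    (hx : ∀ n, ∀ k < 2 ^ n, edist (x (dyadicPoint n k)) (x (dyadicPoint n (k + 1))) ≤ m n)
    (hm : ∑' n, m n ≠ ∞) :
    ∃ y : Set.Icc (0 : ℝ) 1 → ℝ, Continuous y ∧
      (∀ t, Tendsto (fun n => x (dyadicFloor n t)) atTop (𝓝 (y t))) ∧
      ∀ t, edist (x 0) (y t) ≤ ∑' n, m n := by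
  have hsucc := edist_dyadicFloor_succ_le hx
  have hm1 : ∑' n, m (n + 1) ≠ ∞ :=
    ne_top_of_le_ne_top hm (ENNReal.tsum_comp_le_tsum_of_injective (add_left_injective 1) m)
  choose y hy using fun t => cauchySeq_tendsto_of_complete
    (cauchySeq_of_edist_le_of_tsum_ne_top _ (fun n => hsucc n t) hm1)
  have htail : ∀ n t, edist (x (dyadicFloor n t)) (y t) ≤ ∑' k, m (n + k + 1) := fun n t =>
    edist_le_tsum_of_edist_le_of_tendsto (fun n => m (n + 1)) (fun n => hsucc n t) (hy t) n
  refine ⟨y, ?_, hy, fun t => ?_⟩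
  · have hlim : Tendsto (fun n => (∑' k, m (n + k + 1)) + (m n + ∑' k, m (n + k + 1))) atTop
        (𝓝 0) := by
      have h1 : Tendsto (fun n => ∑' k, m (n + k + 1)) atTop (𝓝 0) := by
        have := ENNReal.tendsto_sum_nat_add (fun n => m (n + 1)) hm1
        refine this.congr fun n => tsum_congr fun k => ?_
        rw [add_comm k n]
      simpa using h1.add ((ENNReal.tendsto_atTop_zero_of_tsum_ne_top hm).add h1)
    refine EMetric.continuous_iff.2 fun t ε hε => ?_
    obtain ⟨n, hn⟩ := (hlim.eventually_lt_const hε).exists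
    refine ⟨ENNReal.ofReal ((1 / 2) ^ n), by simp, fun s hs => ?_⟩
    have hst : |(s : ℝ) - t| < (1 / 2) ^ n := by
      rw [edist_dist] at hs
      exact (ENNReal.ofReal_lt_ofReal_iff (by positivity)).1 hs
    refine lt_of_le_of_lt ?_ hn
    refine (edist_triangle _ (x (dyadicFloor n s)) _).trans ?_
    refine add_le_add (by rw [edist_comm]; exact htail n s) ?_
    exact (edist_triangle _ (x (dyadicFloor n t)) _).trans
      (add_le_add (edist_dyadicFloor_le hx n hst) (htail n t))
  -- The floor at level 0 is 0 or 1, and the term `m 0` pays for the possible jump from 0 to 1; the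
  -- remaining terms bound the chain from there to t.
  · rw [tsum_eq_zero_add' ENNReal.summable]
    refine (edist_triangle _ (x (dyadicFloor 0 t)) _).trans (add_le_add ?_ ?_)
    · have h1 := floor_mul_two_pow_le 0 t
      rw [dyadicFloor, ← dyadicPoint_zero_right 0]
      rcases (show ⌊(t : ℝ) * 2 ^ 0⌋₊ = 0 ∨ ⌊(t : ℝ) * 2 ^ 0⌋₊ = 0 + 1 by omega) with h | h
      · rw [h]; simp
      · rw [h]; exact hx 0 0 (by simp)
    · simpa using htail 0 t

end Paths

/-! ### Kolmogorov's continuity criterion for second moments -/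

section Chaining

variable {S : Type*}

/-- The root of the sum of the squared increments of `X` between neighbouring dyadic points of
level `n`. -/
noncomputable def dyadicOscillation (X : Set.Icc (0 : ℝ) 1 → S → ℝ) (n : ℕ) (s : S) : ℝ≥0∞ :=
  (∑ k ∈ Finset.range (2 ^ n),
    ‖X (dyadicPoint n k) s - X (dyadicPoint n (k + 1)) s‖ₑ ^ (2 : ℝ)) ^ (1 / 2 : ℝ)

theorem edist_le_dyadicOscillation (X : Set.Icc (0 : ℝ) 1 → S → ℝ) (s : S) {n k : ℕ}
    (hk : k < 2 ^ n) :
    edist (X (dyadicPoint n k) s) (X (dyadicPoint n (k + 1)) s) ≤ dyadicOscillation X n s := by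
  rw [dyadicOscillation, edist_eq_enorm_sub, one_div, ENNReal.le_rpow_inv_iff (by norm_num)]
  exact Finset.single_le_sum
    (f := fun k => ‖X (dyadicPoint n k) s - X (dyadicPoint n (k + 1)) s‖ₑ ^ (2 : ℝ))
    (fun _ _ => zero_le) (Finset.mem_range.2 hk)

variable [MeasurableSpace S] {P : Measure S}

theorem aemeasurable_dyadicOscillation {X : Set.Icc (0 : ℝ) 1 → S → ℝ}
    (hX : ∀ t, AEStronglyMeasurable (X t) P) (n : ℕ) :
    AEMeasurable (dyadicOscillation X n) P := by
  unfold dyadicOscillation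
  refine AEMeasurable.pow_const (Finset.aemeasurable_fun_sum _ fun k _ => ?_) _
  exact ((hX _).sub (hX _)).enorm.pow_const _

/-- The ℓ² norm dominates the largest increment and has a computable second moment. The factor 2^n
for the number of increments is absorbed by the exponent 1 + α > 1 when α > 0. -/
theorem lintegral_dyadicOscillation_le [IsProbabilityMeasure P] {X : Set.Icc (0 : ℝ) 1 → S → ℝ}
    {α : ℝ} {c : ℝ≥0∞} (hX : ∀ t, AEStronglyMeasurable (X t) P)
    (hinc : ∀ t r : Set.Icc (0 : ℝ) 1, eLpNorm (fun s => X t s - X r s) 2 P ≤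
      c * ENNReal.ofReal (|(t : ℝ) - r| ^ ((1 + α) / 2))) (n : ℕ) :
    ∫⁻ s, dyadicOscillation X n s ∂P ≤ c * ENNReal.ofReal (2 ^ (-(α / 2))) ^ n := by
  have hm := aemeasurable_dyadicOscillation hX n
  -- Cauchy–Schwarz against the constant 1 on a probability space.
  have h1 : ∫⁻ s, dyadicOscillation X n s ∂P ≤
      (∫⁻ s, dyadicOscillation X n s ^ (2 : ℝ) ∂P) ^ (1 / 2 : ℝ) := by
    have := ENNReal.lintegral_mul_le_Lp_mul_Lq P Real.HolderConjugate.two_two hm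
      (aemeasurable_const (b := 1))
    simpa using this
  refine h1.trans ?_
  rw [one_div, ENNReal.rpow_inv_le_iff (by norm_num)]
  have h2 : ∀ s, dyadicOscillation X n s ^ (2 : ℝ) = ∑ k ∈ Finset.range (2 ^ n),
      ‖X (dyadicPoint n k) s - X (dyadicPoint n (k + 1)) s‖ₑ ^ (2 : ℝ) := by
    intro s
    rw [dyadicOscillation, ← ENNReal.rpow_mul]
    norm_num
  simp only [h2]
  have hmk : ∀ k ∈ Finset.range (2 ^ n), AEMeasurable
      (fun s => ‖X (dyadicPoint n k) s - X (dyadicPoint n (k + 1)) s‖ₑ ^ (2 : ℝ)) P :=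
    fun k _ => ((hX _).sub (hX _)).enorm.pow_const _
  rw [lintegral_finsetSum' _ hmk]
  have h3 : ∀ k ∈ Finset.range (2 ^ n),
      ∫⁻ s, ‖X (dyadicPoint n k) s - X (dyadicPoint n (k + 1)) s‖ₑ ^ (2 : ℝ) ∂P ≤
        (c * ENNReal.ofReal (((1 / 2) ^ n) ^ ((1 + α) / 2))) ^ (2 : ℝ) := by
    intro k hk
    have hk := Finset.mem_range.1 hk
    have h := hinc (dyadicPoint n k) (dyadicPoint n (k + 1))
    have hd : |(dyadicPoint n k : ℝ) - dyadicPoint n (k + 1)| = (1 / 2) ^ n := by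
      rw [coe_dyadicPoint hk.le, coe_dyadicPoint hk, ← sub_div]
      push_cast
      rw [sub_add_cancel_left, abs_div, abs_neg, abs_one, abs_of_pos (by positivity), one_div,
        one_div, inv_pow]
    rw [hd, eLpNorm_eq_lintegral_rpow_enorm_toReal (by simp) (by simp), ENNReal.toReal_ofNat,
      one_div (2 : ℝ), ENNReal.rpow_inv_le_iff (by norm_num)] at h
    simpa only [one_div] using h
  refine (Finset.sum_le_sum h3).trans (le_of_eq ?_)
  -- The exponents combine as n - n(1 + α) = -nα.
  have h4 : (2 : ℝ) ^ n * ((((1 / 2) ^ n) ^ ((1 + α) / 2)) ^ 2) = (((2 : ℝ) ^ (-(α / 2))) ^ n) ^ 2 := by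
    rw [one_div, inv_pow, Real.inv_rpow (by positivity), ← Real.rpow_neg (by positivity),
      ← Real.rpow_natCast, ← Real.rpow_natCast, ← Real.rpow_natCast, ← Real.rpow_natCast,
      ← Real.rpow_mul (by positivity), ← Real.rpow_mul (by positivity),
      ← Real.rpow_mul (by positivity), ← Real.rpow_mul (by positivity),
      ← Real.rpow_add (by positivity)]
    congr 1
    push_cast
    ring
  rw [Finset.sum_const, Finset.card_range, nsmul_eq_mul, ENNReal.rpow_ofNat, ENNReal.rpow_ofNat,
    mul_pow, mul_pow, mul_left_comm, ← ENNReal.ofReal_pow (by positivity),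
    ← ENNReal.ofReal_pow (by positivity), ← ENNReal.ofReal_pow (by positivity), ← h4,
    ENNReal.ofReal_mul (by positivity)]
  norm_num

/-- A process whose increments satisfy `‖X t - X r‖₂ ≤ c |t - r| ^ ((1 + α) / 2)` has a continuous
modification, with an explicit bound on the mean oscillation of its paths. -/
theorem exists_continuous_modification [IsProbabilityMeasure P] {X : Set.Icc (0 : ℝ) 1 → S → ℝ}
    {α : ℝ} (hα : 0 < α) {c : ℝ≥0∞} (hc : c ≠ ∞) (hX : ∀ t, AEStronglyMeasurable (X t) P)
    (hinc : ∀ t r : Set.Icc (0 : ℝ) 1, eLpNorm (fun s => X t s - X r s) 2 P ≤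
      c * ENNReal.ofReal (|(t : ℝ) - r| ^ ((1 + α) / 2))) :
    ∃ (Y : Set.Icc (0 : ℝ) 1 → S → ℝ) (R : S → ℝ≥0∞), (∀ s, Continuous fun t => Y t s) ∧
      (∀ t, X t =ᵐ[P] Y t) ∧ AEMeasurable R P ∧
      ∫⁻ s, R s ∂P ≤ c * (1 - ENNReal.ofReal (2 ^ (-(α / 2))))⁻¹ ∧
      ∀ᵐ s ∂P, ∀ t, edist (X 0 s) (Y t s) ≤ R s := by
  have hm := aemeasurable_dyadicOscillation hX
  have hR : AEMeasurable (fun s => ∑' n, dyadicOscillation X n s) P := AEMeasurable.tsum hm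
  have hint : ∫⁻ s, ∑' n, dyadicOscillation X n s ∂P ≤
      c * (1 - ENNReal.ofReal (2 ^ (-(α / 2))))⁻¹ := by
    rw [lintegral_tsum hm, ← ENNReal.tsum_geometric, ← ENNReal.tsum_mul_left]
    exact ENNReal.tsum_le_tsum fun n => lintegral_dyadicOscillation_le hX hinc n
  have hρ : ENNReal.ofReal (2 ^ (-(α / 2))) < 1 := by
    rw [ENNReal.ofReal_lt_one]
    exact Real.rpow_lt_one_of_one_lt_of_neg one_lt_two (by linarith)
  have hfin : ∀ᵐ s ∂P, ∑' n, dyadicOscillation X n s < ∞ :=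
    ae_lt_top' hR (ne_top_of_le_ne_top
      (ENNReal.mul_ne_top hc (ENNReal.inv_ne_top.2 (tsub_pos_of_lt hρ).ne')) hint)
  have key : ∀ s, ∃ y : Set.Icc (0 : ℝ) 1 → ℝ, Continuous y ∧
      (∑' n, dyadicOscillation X n s < ∞ →
        (∀ t, Tendsto (fun n => X (dyadicFloor n t) s) atTop (𝓝 (y t))) ∧
        ∀ t, edist (X 0 s) (y t) ≤ ∑' n, dyadicOscillation X n s) := by
    intro s
    by_cases hs : ∑' n, dyadicOscillation X n s < ∞
    · obtain ⟨y, h1, h2⟩ := exists_continuous_of_dyadic (x := fun t => X t s)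
        (fun n k hk => edist_le_dyadicOscillation X s hk) hs.ne
      exact ⟨y, h1, fun _ => h2⟩
    -- On the null set where the chaining sum diverges the path is set to 0, so that every path is
    -- continuous.
    · exact ⟨fun _ => 0, continuous_const, fun h => absurd h hs⟩
  choose y hy_cont hy using key
  refine ⟨fun t s => y s t, _, hy_cont, fun t => ?_, hR, hint, ?_⟩
  · have h1 : TendstoInMeasure P (fun n => X (dyadicFloor n t)) atTop (X t) := by
      refine tendstoInMeasure_of_tendsto_eLpNorm (p := 2) (by simp) (fun n => hX _) (hX t) ?_
      refine tendsto_of_tendsto_of_tendsto_of_le_of_le tendsto_const_nhds ?_ (fun _ => zero_le)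
        fun n => hinc (dyadicFloor n t) t
      have h2 : Tendsto (fun n => |(dyadicFloor n t : ℝ) - t|) atTop (𝓝 0) :=
        squeeze_zero (fun _ => abs_nonneg _) (fun n => abs_dyadicFloor_sub_le n t)
          (tendsto_pow_atTop_nhds_zero_of_lt_one (by norm_num) (by norm_num))
      have hβ : 0 < (1 + α) / 2 := by linarith
      have h3 := (h2.rpow_const (p := (1 + α) / 2) (Or.inr hβ.le))
      rw [Real.zero_rpow hβ.ne'] at h3
      simpa using ENNReal.Tendsto.const_mul (ENNReal.tendsto_ofReal h3) (Or.inr hc)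
    have h2 : TendstoInMeasure P (fun n => X (dyadicFloor n t)) atTop (fun s => y s t) := by
      refine tendstoInMeasure_of_tendsto_ae (fun n => hX _) ?_
      filter_upwards [hfin] with s hs using (hy s hs).1 t
    exact tendstoInMeasure_ae_unique h1 h2
  · filter_upwards [hfin] with s hs using (hy s hs).2

end Chaining

/-! ### The truncated process -/

section Truncation

variable {Ω : Type*} [MeasurableSpace Ω] {ν : Measure (Set.Ioo (-1 : ℝ) 1 × Ω)}

/-- The set `{0 < |u| < ε}`. -/
def truncationSet (Ω : Type*) (ε : ℝ) : Set (Set.Ioo (-1 : ℝ) 1 × Ω) :=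
  {x | 0 < |(x.1 : ℝ)| ∧ |(x.1 : ℝ)| < ε}

theorem measurableSet_truncationSet (ε : ℝ) : MeasurableSet (truncationSet Ω ε) := by
  have hm : Measurable fun x : Set.Ioo (-1 : ℝ) 1 × Ω => |(x.1 : ℝ)| := by fun_prop
  exact (measurableSet_lt measurable_const hm).inter (measurableSet_lt hm measurable_const)

/-- Dominated convergence: the sets decrease to the empty set, because u = 0 is excluded and any
other u leaves once ε ≤ |u|. -/
theorem tendsto_eLpNorm_indicator_truncationSet {f : Set.Ioo (-1 : ℝ) 1 × Ω → ℝ}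
    (hf : MemLp f 2 ν) :
    Tendsto (fun ε => eLpNorm ((truncationSet Ω ε).indicator f) 2 ν) (𝓝[>] 0) (𝓝 0) := by
  have hfin : ∫⁻ x, ‖f x‖ₑ ^ (2 : ℝ) ∂ν ≠ ∞ := by
    simpa using (lintegral_rpow_enorm_lt_top_of_eLpNorm_lt_top (by simp) (by simp) hf.2).ne
  have h : Tendsto (fun ε => ∫⁻ x, ‖(truncationSet Ω ε).indicator f x‖ₑ ^ (2 : ℝ) ∂ν) (𝓝[>] 0)
      (𝓝 (∫⁻ _, 0 ∂ν)) := by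
    refine tendsto_lintegral_filter_of_dominated_convergence' (fun x => ‖f x‖ₑ ^ (2 : ℝ)) ?_ ?_ hfin
      ?_
    · exact Eventually.of_forall fun ε =>
        ((hf.1.indicator (measurableSet_truncationSet ε)).enorm.pow_const _)
    · refine Eventually.of_forall fun ε => Eventually.of_forall fun x => ?_
      gcongr
      exact enorm_indicator_le_enorm_self _ _
    · refine Eventually.of_forall fun x => ?_
      refine tendsto_const_nhds.congr' ?_
      rcases (abs_nonneg (x.1 : ℝ)).eq_or_lt with hx | hx
      · refine Eventually.of_forall fun ε => ?_
        have hmem : x ∉ truncationSet Ω ε := fun h => h.1.ne hx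
        simp [Set.indicator_of_notMem hmem]
      · filter_upwards [nhdsWithin_le_nhds (Iic_mem_nhds hx)] with ε hε
        have hmem : x ∉ truncationSet Ω ε := fun h => h.2.not_ge hε
        simp [Set.indicator_of_notMem hmem]
  have h2 := h.ennrpow_const (1 / 2)
  simp only [lintegral_zero] at h2
  rw [ENNReal.zero_rpow_of_pos (by norm_num)] at h2
  refine h2.congr fun ε => ?_
  rw [eLpNorm_eq_lintegral_rpow_enorm_toReal (by simp) (by simp), ENNReal.toReal_ofNat]

variable {K : Set.Icc (0 : ℝ) 1 → Ω → ℝ}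

theorem memLp_kernel_mul (hK_meas : Measurable (Function.uncurry K))
    (hK_sq : ∀ t, ∫⁻ x, ENNReal.ofReal (K t x.2 ^ 2 * (x.1 : ℝ) ^ 2) ∂ν < ∞)
    (t : Set.Icc (0 : ℝ) 1) :
    MemLp (fun x : Set.Ioo (-1 : ℝ) 1 × Ω => K t x.2 * (x.1 : ℝ)) 2 ν := by
  have hK : Measurable (K t) := hK_meas.of_uncurry_left
  have hm : Measurable fun x : Set.Ioo (-1 : ℝ) 1 × Ω => K t x.2 * (x.1 : ℝ) := by fun_prop
  rw [memLp_two_iff_integrable_sq hm.aestronglyMeasurable]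
  refine ⟨(hm.pow_const 2).aestronglyMeasurable, ?_⟩
  rw [hasFiniteIntegral_iff_ofReal (Eventually.of_forall fun _ => sq_nonneg _)]
  simpa only [mul_pow] using hK_sq t

theorem memLp_sqrt_mul {C : Ω → ℝ} (hC_meas : Measurable C) (hC_nonneg : ∀ ω, 0 ≤ C ω)
    (hC_int : ∫⁻ x, ENNReal.ofReal (C x.2 * (x.1 : ℝ) ^ 2) ∂ν < ∞) :
    MemLp (fun x : Set.Ioo (-1 : ℝ) 1 × Ω => √(C x.2) * (x.1 : ℝ)) 2 ν := by
  have hm : Measurable fun x : Set.Ioo (-1 : ℝ) 1 × Ω => √(C x.2) * (x.1 : ℝ) := by fun_prop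
  rw [memLp_two_iff_integrable_sq hm.aestronglyMeasurable]
  refine ⟨(hm.pow_const 2).aestronglyMeasurable, ?_⟩
  rw [hasFiniteIntegral_iff_ofReal (Eventually.of_forall fun _ => sq_nonneg _)]
  simpa only [mul_pow, Real.sq_sqrt (hC_nonneg _)] using hC_int

/-- The square root of the Hölder bound holds pointwise on the truncation set. All dependence on ε
ends up in the norm of √C·u. -/
theorem eLpNorm_truncatedIntegrand_sub_le {α : ℝ} {C : Ω → ℝ} (hC_nonneg : ∀ ω, 0 ≤ C ω)
    (hK_lip : ∀ (s t : Set.Icc (0 : ℝ) 1) (ω : Ω),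
      |K t ω - K s ω| ^ 2 ≤ C ω * |(t : ℝ) - (s : ℝ)| ^ (1 + α))
    (ε : ℝ) (t r : Set.Icc (0 : ℝ) 1) :
    eLpNorm (fun x => truncatedIntegrand K ε t x - truncatedIntegrand K ε r x) 2 ν ≤
      eLpNorm ((truncationSet Ω ε).indicator fun x => √(C x.2) * (x.1 : ℝ)) 2 ν *
        ENNReal.ofReal (|(t : ℝ) - r| ^ ((1 + α) / 2)) := by
  rw [mul_comm]
  refine eLpNorm_le_mul_eLpNorm_of_ae_le_mul (Eventually.of_forall fun x => ?_) 2
  change ‖(truncationSet Ω ε).indicator (fun x => K t x.2 * (x.1 : ℝ)) x -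
    (truncationSet Ω ε).indicator (fun x => K r x.2 * (x.1 : ℝ)) x‖ ≤ _
  by_cases hx : x ∈ truncationSet Ω ε
  · rw [Set.indicator_of_mem hx, Set.indicator_of_mem hx, Set.indicator_of_mem hx, ← sub_mul,
      norm_mul, norm_mul, ← mul_assoc]
    refine mul_le_mul_of_nonneg_right ?_ (norm_nonneg _)
    have h1 := Real.sqrt_le_sqrt (hK_lip r t x.2)
    rw [Real.sqrt_sq (abs_nonneg _), Real.sqrt_mul (hC_nonneg _), Real.sqrt_eq_rpow (|_| ^ _),
      ← Real.rpow_mul (abs_nonneg _), mul_comm, mul_one_div] at h1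
    rwa [Real.norm_eq_abs, Real.norm_of_nonneg (Real.sqrt_nonneg _)]
  · rw [Set.indicator_of_notMem hx, Set.indicator_of_notMem hx, Set.indicator_of_notMem hx]
    simp

end Truncation

/-! ### Separable versions and the main result -/

/-- A separable process that is a modification of a continuous process is almost surely equal to
it at all times. -/
theorem IsSeparableProcess.ae_forall_eq {S T : Type*} [MeasurableSpace S] [TopologicalSpace T]
    {P : Measure S} {X Y : T → S → ℝ} (hX : IsSeparableProcess P X)
    (hXY : ∀ t, X t =ᵐ[P] Y t) (hY : ∀ s, Continuous fun t => Y t s) :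
    ∀ᵐ s ∂P, ∀ t, X t s = Y t s := by
  obtain ⟨D, hD, hsep⟩ := hX
  filter_upwards [hsep, (ae_ball_iff hD).2 fun t _ => hXY t] with s hs hsD t
  -- The graph of a continuous path is closed, so containing the graph of X over D it contains the
  -- closure as well.
  have hcl : IsClosed {p : T × ℝ | p.2 = Y p.1 s} :=
    isClosed_eq continuous_snd ((hY s).comp continuous_fst)
  exact closure_minimal (by rintro _ ⟨r, hr, rfl⟩; exact hsD r hr) hcl (hs t)

theorem proposition1 {S Ω : Type*} [MeasurableSpace S]
    [TopologicalSpace Ω] [PolishSpace Ω] [MeasurableSpace Ω] [BorelSpace Ω]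
    (P : Measure S) [IsProbabilityMeasure P]
    (ν : Measure (Set.Ioo (-1 : ℝ) 1 × Ω)) [SigmaFinite ν]
    (hν_inf : ∀ a : ℝ, 0 < a → a ≤ 1 → ν {x | |(x.1 : ℝ)| < a} = ∞)
    (hν_sq : ∫⁻ x, ENNReal.ofReal ((x.1 : ℝ) ^ 2) ∂ν < ∞)
    (N : S → Measure (Set.Ioo (-1 : ℝ) 1 × Ω)) (hN : IsPoissonRandomMeasure P N ν)
    (K : Set.Icc (0 : ℝ) 1 → Ω → ℝ) (hK_meas : Measurable (Function.uncurry K))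
    (hK_sq : ∀ t, ∫⁻ x, ENNReal.ofReal (K t x.2 ^ 2 * (x.1 : ℝ) ^ 2) ∂ν < ∞)
    (α : ℝ) (hα : 0 < α)
    (C : Ω → ℝ) (hC_meas : Measurable C) (hC_nonneg : ∀ ω, 0 ≤ C ω)
    (hC_int : ∫⁻ x, ENNReal.ofReal (C x.2 * (x.1 : ℝ) ^ 2) ∂ν < ∞)
    (hK_lip : ∀ (s t : Set.Icc (0 : ℝ) 1) (ω : Ω),
      |K t ω - K s ω| ^ 2 ≤ C ω * |(t : ℝ) - (s : ℝ)| ^ (1 + α)) :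
    (∀ ε : ℝ, 0 < ε → ε ≤ 1 → ∃ X : Set.Icc (0 : ℝ) 1 → S → ℝ,
      IsVersionOfProcess P N ν K ε X ∧ ∀ s, Continuous (fun t => X t s)) ∧
    ∀ X : ℝ → Set.Icc (0 : ℝ) 1 → S → ℝ,
      (∀ ε : ℝ, 0 < ε → ε ≤ 1 →
        IsVersionOfProcess P N ν K ε (X ε) ∧ IsSeparableProcess P (X ε)) →
      ∀ δ : ℝ, 0 < δ →
        Tendsto (fun ε : ℝ => P {s | (δ : EReal) < ⨆ t, ((|X ε t s| : ℝ) : EReal)})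
          (𝓝[>] 0) (𝓝 0) := by
  have hCL := memLp_sqrt_mul hC_meas hC_nonneg hC_int
  have hKL := memLp_kernel_mul hK_meas hK_sq
  set c : ℝ → ℝ≥0∞ := fun ε =>
    eLpNorm ((truncationSet Ω ε).indicator fun x => √(C x.2) * (x.1 : ℝ)) 2 ν with hc_def
  have hc : ∀ ε, c ε ≠ ∞ := fun ε => (hCL.indicator (measurableSet_truncationSet ε)).2.ne
  set κ : ℝ≥0∞ := (1 - ENNReal.ofReal (2 ^ (-(α / 2))))⁻¹ with hκ_def
  have hκ : κ ≠ ∞ := by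
    refine ENNReal.inv_ne_top.2 (tsub_pos_of_lt ?_).ne'
    rw [ENNReal.ofReal_lt_one]
    exact Real.rpow_lt_one_of_one_lt_of_neg one_lt_two (by linarith)
  have hmod : ∀ (ε : ℝ) (X : Set.Icc (0 : ℝ) 1 → S → ℝ), IsVersionOfProcess P N ν K ε X →
      ∃ (Y : Set.Icc (0 : ℝ) 1 → S → ℝ) (R : S → ℝ≥0∞), (∀ s, Continuous fun t => Y t s) ∧
        (∀ t, X t =ᵐ[P] Y t) ∧ AEMeasurable R P ∧ ∫⁻ s, R s ∂P ≤ c ε * κ ∧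
        ∀ᵐ s ∂P, ∀ t, edist (X 0 s) (Y t s) ≤ R s := fun ε X hX =>
    exists_continuous_modification hα (hc ε) (fun t => (hX t).2.1.1) fun t r =>
      ((hX t).eLpNorm_sub_le hN (hX r)).trans
        (eLpNorm_truncatedIntegrand_sub_le hC_nonneg hK_lip ε t r)
  refine ⟨fun ε _ _ => ?_, fun X hX δ hδ => ?_⟩
  · choose X hX using fun t => hN.exists_isCompensatedIntegral
      ((hKL t).indicator (measurableSet_truncationSet ε))
    obtain ⟨Y, R, hY, hXY, -⟩ := hmod ε X hX
    exact ⟨Y, fun t => IsCompensatedIntegral.congr_ae (hX t) (hXY t), hY⟩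
  -- This is the Markov bound for |X_0| + R at level δ.
  · have hlim : Tendsto (fun ε => (eLpNorm (truncatedIntegrand K ε 0) 2 ν + c ε * κ) /
        ENNReal.ofReal δ) (𝓝[>] 0) (𝓝 0) := by
      have h1 := tendsto_eLpNorm_indicator_truncationSet (hKL 0)
      have h2 := ENNReal.Tendsto.mul_const (tendsto_eLpNorm_indicator_truncationSet hCL)
        (Or.inr hκ)
      have h3 := ENNReal.Tendsto.div_const (h1.add h2) (b := ENNReal.ofReal δ)
        (Or.inr (ENNReal.ofReal_pos.2 hδ).ne')
      simp only [zero_mul, add_zero, ENNReal.zero_div] at h3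
      exact h3
    refine tendsto_of_tendsto_of_tendsto_of_le_of_le' tendsto_const_nhds hlim
      (Eventually.of_forall fun _ => zero_le) ?_
    filter_upwards [Ioc_mem_nhdsGT one_pos] with ε hε
    obtain ⟨hv, hsep⟩ := hX ε hε.1 hε.2
    obtain ⟨Y, R, hY, hXY, hR, hRint, hbound⟩ := hmod ε (X ε) hv
    have hX0 : AEStronglyMeasurable (X ε 0) P := (hv 0).2.1.1
    have hsub : {s | (δ : EReal) < ⨆ t, ((|X ε t s| : ℝ) : EReal)} ≤ᵐ[P]
        {s | ENNReal.ofReal δ ≤ ‖X ε 0 s‖ₑ + R s} := by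
      filter_upwards [hsep.ae_forall_eq hXY hY, hbound] with s hs hb hsup
      -- In `EReal` the supremum exceeds δ exactly when some value does, also on unbounded paths.
      obtain ⟨t, ht⟩ := lt_iSup_iff.1 (show (δ : EReal) < ⨆ t, ((|X ε t s| : ℝ) : EReal) from hsup)
      have ht' : δ < |X ε t s| := EReal.coe_lt_coe_iff.1 ht
      calc ENNReal.ofReal δ ≤ ENNReal.ofReal |X ε t s| := ENNReal.ofReal_le_ofReal ht'.le
        _ = edist 0 (X ε t s) := by rw [← Real.enorm_eq_ofReal_abs, edist_comm, edist_zero_right]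
        _ ≤ edist 0 (X ε 0 s) + edist (X ε 0 s) (X ε t s) := edist_triangle _ _ _
        _ ≤ ‖X ε 0 s‖ₑ + R s := by
          rw [edist_comm, edist_zero_right, hs t]
          exact add_le_add_right (hb t) _
    refine (measure_mono_ae hsub).trans ?_
    refine (meas_ge_le_lintegral_div (hX0.enorm.add hR) (ENNReal.ofReal_pos.2 hδ).ne'
      ENNReal.ofReal_ne_top).trans ?_
    refine ENNReal.div_le_div_right ?_ _
    simp only [Pi.add_apply]
    rw [lintegral_add_left' hX0.enorm]
    refine add_le_add ?_ hRint
    -- On a probability space E|X_0| ≤ ‖X_0‖₂, which is at most the L²(ν) norm of the integrand.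
    rw [← eLpNorm_one_eq_lintegral_enorm]
    exact (eLpNorm_le_eLpNorm_of_exponent_le one_le_two hX0).trans
      (IsCompensatedIntegral.eLpNorm_le hN (hv 0))
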